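/- For real $x$ let $\|x\|$ denote the distance from $x$ to the nearest integer, let $\mathbb{N}=\{1,2,\dots\}$, and write $L(x) = \log\max\{e,x\}$. Let $\alpha$ be a badly approximable irrational, i.e. an irrational number with $\inf_{n\in\mathbb{N}} n\|n\alpha\|>0$, and let $\beta\in\mathbb{R}$. For every integer $N\ge 1$, \[ \sum_{\substack{n=1\\ n\ne n_0}}^N \frac{1}{\|n\alpha+\beta\|} = 2N\log N + O\big(N\,L(L(N))\big) \] with an implied constant depending only on $\alpha$ (in particular not on $\beta$), where $n_0=n_0(\alpha,\beta,N)\in[1,N]$ is any integer with $\|n_0\alpha+\beta\| = \min_{1\le n\le N}\|n\alpha+\beta\|$. If in addition $\inf_{n\in\mathbb{N}} n\,L(L(n))\,\|n\alpha+\beta\|>0$, then for every integer $N\ge 1$, \[ \sum_{n=1}^N \frac{1}{\|n\alpha+\beta\|} = 2N\log N + O\big(N\,L(L(N))\big), \qquad \sum_{n=1}^N \frac{1}{n\|n\alpha+\beta\|} = (\log N)^2 + O\big(L(N)\,L(L(N))\big) \] with implied constants depending only on $\alpha$ and $\beta$. -/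

import Mathlib

/-- The distance `‖x‖` from a real number `x` to the nearest integer. -/
noncomputable def distNearestInt (x : ℝ) : ℝ := |x - round x|

/-- The truncated logarithm `log max {e, x}`, which is at least `1` everywhere. -/
noncomputable def truncLog (x : ℝ) : ℝ := Real.log (max (Real.exp 1) x)

/-- An irrational `α` is badly approximable if `inf_{n ≥ 1} n ‖n α‖ > 0`. -/
def IsBadlyApproximable (α : ℝ) : Prop :=
  Irrational α ∧ 0 < ⨅ n : ℕ+, ((n : ℕ) : ℝ) * distNearestInt ((n : ℕ) * α)

/-! The sum is an integral of A(t)/t², where A(t) counts the n ≤ N with ‖nα+β‖ ≤ t. Two estimates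
for A suffice, both uniform in β. (1) A(t) = 2Nt + O(log N). A block whose length is the denominator
q of a good rational approximation is equidistributed up to O(1). Bad approximability gives such a q
≥ cN, so peeling off blocks takes O(log N) steps (`countNear_le`). The lower bound is the upper
bound for β + 1/2. (2) The points nα+β are c/N-separated mod 1, so A(t) = O(Nt) once t ≥ c/(2N)
(`card_filter_le_of_separated`), and every term except the minimal one lies in that range. Using (2)
below δ = L(N)/(2N) and (1) above it, `abs_sum_one_div_sub_le` yields the main term 2N log N with
errors O(N log L(N)) and O(N). The extra hypothesis on β controls the omitted term, and Abel
summation gives the weighted sum. -/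

/-! ### Distance to the nearest integer -/

theorem distNearestInt_nonneg (x : ℝ) : 0 ≤ distNearestInt x := abs_nonneg _

theorem distNearestInt_le_half (x : ℝ) : distNearestInt x ≤ 1 / 2 := abs_sub_round x

theorem distNearestInt_le_abs_sub_intCast (x : ℝ) (m : ℤ) : distNearestInt x ≤ |x - m| :=
  round_le x m

theorem distNearestInt_add_half_le (x : ℝ) :
    distNearestInt (x + 1 / 2) ≤ 1 / 2 - distNearestInt x := by
  have hx := distNearestInt_le_half x
  unfold distNearestInt at hx
  rcases le_total 0 (x - round x) with h | h
  · have := distNearestInt_le_abs_sub_intCast (x + 1 / 2) (round x + 1)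
    push_cast at this
    rw [abs_of_nonneg h] at hx
    rw [abs_of_nonpos (by linarith)] at this
    rw [distNearestInt, distNearestInt, abs_of_nonneg h]
    rw [distNearestInt] at this
    linarith
  · have := distNearestInt_le_abs_sub_intCast (x + 1 / 2) (round x)
    rw [abs_of_nonpos h] at hx
    rw [abs_of_nonneg (by linarith)] at this
    rw [distNearestInt, distNearestInt, abs_of_nonpos h]
    rw [distNearestInt] at this
    linarith

/-! ### Upper bounds for the counting function -/

theorem card_int_Icc_le {a b : ℝ} (h : a ≤ b + 1) :
    ((Finset.Icc ⌈a⌉ ⌊b⌋).card : ℝ) ≤ b - a + 1 := by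
  rw [Int.card_Icc]
  rcases le_total 0 (⌊b⌋ + 1 - ⌈a⌉) with h0 | h0
  · have : (((⌊b⌋ + 1 - ⌈a⌉).toNat : ℤ) : ℝ) = ((⌊b⌋ + 1 - ⌈a⌉ : ℤ) : ℝ) := by
      rw [Int.toNat_of_nonneg h0]
    push_cast at this
    rw [this]
    linarith [Int.floor_le b, Int.le_ceil a]
  · rw [Int.toNat_of_nonpos h0]
    push_cast
    linarith

/-- The number of `n < N` with `‖n α + β‖ ≤ t`. -/
noncomputable def countNear (α β : ℝ) (N : ℕ) (t : ℝ) : ℕ :=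
  ((Finset.range N).filter fun n : ℕ => distNearestInt (n * α + β) ≤ t).card

theorem countNear_add (α β : ℝ) (M N : ℕ) (t : ℝ) :
    countNear α β (M + N) t = countNear α β M t + countNear α (β + M * α) N t := by
  simp only [countNear, Finset.card_filter]
  rw [Finset.sum_range_add]
  congr 1
  refine Finset.sum_congr rfl fun n _ => ?_
  have : ((M + n : ℕ) : ℝ) * α + β = n * α + (β + M * α) := by push_cast; ring
  rw [this]

/-- With r = p/q, the integers np - q·round(nα+β) are distinct mod q, since p is invertible there.
Each is within qt + 1 of -qβ, the 1 coming from replacing α by r. -/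
theorem countNear_den_le {α : ℝ} {r : ℚ} (hr : |α - r| ≤ 1 / (r.den : ℝ) ^ 2) (β : ℝ) {t : ℝ}
    (ht : 0 ≤ t) : (countNear α β r.den t : ℝ) ≤ 2 * t * r.den + 3 := by
  have hq : (0 : ℝ) < r.den := by exact_mod_cast r.den_pos
  set q : ℝ := (r.den : ℝ) with hqdef
  have hcard : countNear α β r.den t ≤
      (Finset.Icc ⌈-(q * t) - 1 - q * β⌉ ⌊q * t + 1 - q * β⌋).card := by
    refine Finset.card_le_card_of_injOn
      (fun n : ℕ => (n : ℤ) * r.num - r.den * round (n * α + β)) ?_ ?_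
    · intro n hn
      simp only [Finset.coe_filter, Finset.mem_range, Set.mem_ofPred_eq] at hn
      obtain ⟨hn, hd⟩ := hn
      have hnq : (n : ℝ) ≤ q := by rw [hqdef]; exact_mod_cast hn.le
      have herr : |q * n * (α - r)| ≤ 1 := by
        rw [abs_mul, abs_of_nonneg (by positivity)]
        calc q * n * |α - r| ≤ q * q * (1 / q ^ 2) := by gcongr
          _ = 1 := by field_simp
      have hd' : |q * (n * α + β - round (n * α + β))| ≤ q * t := by
        rw [abs_mul, abs_of_pos hq]
        exact mul_le_mul_of_nonneg_left hd hq.le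
      have key : (((n : ℤ) * r.num - r.den * round (n * α + β) : ℤ) : ℝ) =
          q * (n * α + β - round (n * α + β)) - q * n * (α - r) - q * β := by
        push_cast
        have : q * (r : ℝ) = r.num := by
          have : (r : ℝ) = r.num / r.den := by exact_mod_cast (Rat.num_div_den r).symm
          rw [this, hqdef]; field_simp
        linear_combination (-(n : ℝ)) * this
      rw [abs_le] at herr hd'
      simp only [Finset.coe_Icc, Set.mem_Icc, Int.ceil_le, Int.le_floor]
      rw [key]
      constructor <;> linarith [herr.1, herr.2, hd'.1, hd'.2]
    · intro n hn m hm hnm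
      simp only [Finset.coe_filter, Finset.mem_range, Set.mem_ofPred_eq] at hn hm
      have hdvd : (r.den : ℤ) ∣ ((n : ℤ) - m) * r.num := by
        refine ⟨round (n * α + β) - round (m * α + β), ?_⟩
        simp only at hnm
        linear_combination hnm
      have hcop : IsCoprime (r.den : ℤ) r.num := by
        have := r.reduced
        rw [Int.isCoprime_iff_gcd_eq_one, Int.gcd_comm]
        simpa [Int.gcd, Nat.Coprime] using this
      have h1 := hcop.dvd_of_dvd_mul_right hdvd
      have h2 := Int.eq_zero_of_abs_lt_dvd h1 (by rw [abs_lt]; constructor <;> omega)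
      omega
  calc (countNear α β r.den t : ℝ) ≤ _ := by exact_mod_cast hcard
    _ ≤ _ := card_int_Icc_le (by nlinarith [mul_nonneg hq.le ht])
    _ = _ := by ring

/-- Strong induction on N: a block of length q ≥ cN costs 3 and lowers log N by at least c. Removing
it shifts β by qα, so β must vary in the induction. -/
theorem countNear_le {α c : ℝ} (hc : 0 < c)
    (hα : ∀ n : ℕ, 1 ≤ n → c ≤ n * distNearestInt (n * α)) {t : ℝ} (ht : 0 ≤ t)
    (N : ℕ) (hN : 1 ≤ N) (β : ℝ) :
    (countNear α β N t : ℝ) ≤ 2 * t * N + 3 + 3 / c * Real.log N := by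
  induction N using Nat.strong_induction_on generalizing β with
  | _ N ih =>
    obtain ⟨r, hr, hden⟩ := Real.exists_rat_abs_sub_le_and_den_le α hN
    have hq : (0 : ℝ) < r.den := by exact_mod_cast r.den_pos
    have hN0 : (0 : ℝ) < N := by exact_mod_cast hN
    have hqN : (r.den : ℝ) ≤ N := by exact_mod_cast hden
    have hblock := countNear_den_le (α := α) (r := r) (hr.trans (by
      rw [pow_two]; gcongr; linarith)) β ht
    -- Dirichlet gives ‖qα‖ ≤ 1/(N+1), while bad approximability gives c ≤ q‖qα‖.
    have hlarge : c * N ≤ r.den := by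
      have h1 := hα r.den r.den_pos
      have h2 := distNearestInt_le_abs_sub_intCast (r.den * α) r.num
      have h3 : (r.den : ℝ) * α - r.num = r.den * (α - r) := by
        have : (r : ℝ) = r.num / r.den := by exact_mod_cast (Rat.num_div_den r).symm
        rw [this]; field_simp
      rw [h3, abs_mul, abs_of_pos hq] at h2
      have h4 : (r.den : ℝ) * |α - r| ≤ 1 / (N + 1) := by
        calc (r.den : ℝ) * |α - r| ≤ r.den * (1 / ((N + 1) * r.den)) := by gcongr
          _ = 1 / (N + 1) := by field_simp
      have h5 : c ≤ r.den * (1 / (N + 1)) :=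
        h1.trans (mul_le_mul_of_nonneg_left (h2.trans h4) hq.le)
      rw [mul_one_div, le_div_iff₀ (by positivity)] at h5
      linarith
    rcases hden.eq_or_lt with h | h
    · rw [h] at hblock
      have : 0 ≤ 3 / c * Real.log N :=
        mul_nonneg (by positivity) (Real.log_natCast_nonneg N)
      linarith
    · obtain ⟨m, rfl⟩ := Nat.exists_eq_add_of_le hden
      have hm : 1 ≤ m := by omega
      have hm0 : (0 : ℝ) < m := by exact_mod_cast hm
      have hrec := ih m (by have := r.den_pos; omega) hm (β + r.den * α)
      rw [countNear_add]
      push_cast at hlarge hN0 hqN ⊢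
      have hlog : c ≤ Real.log (r.den + m) - Real.log m := by
        have h1 := Real.one_sub_inv_le_log_of_pos (x := ((r.den : ℝ) + m) / m) (by positivity)
        rw [Real.log_div (by positivity) (by positivity)] at h1
        refine le_trans ?_ h1
        rw [inv_div, one_sub_div (by positivity), le_div_iff₀ (by positivity)]
        linarith
      have h3 : 3 ≤ 3 / c * (Real.log (r.den + m) - Real.log m) := by
        calc (3 : ℝ) = 3 / c * c := by field_simp
          _ ≤ _ := by gcongr
      linarith

/-! ### Partial summation as an integral -/

theorem integral_one_div_sq {a b : ℝ} (ha : 0 < a) (hab : a ≤ b) :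
    ∫ t in a..b, 1 / t ^ 2 = 1 / a - 1 / b := by
  have hpos : ∀ t ∈ Set.uIcc a b, 0 < t := fun t ht => by
    rw [Set.uIcc_of_le hab] at ht; exact ha.trans_le ht.1
  rw [intervalIntegral.integral_eq_sub_of_hasDerivAt (f := fun t => -t⁻¹)]
  · simp only [one_div]; ring
  · intro t ht
    have h := (hasDerivAt_inv (hpos t ht).ne').neg
    rw [neg_neg, ← one_div] at h
    exact h
  · refine ContinuousOn.intervalIntegrable ?_
    exact continuousOn_const.div (continuousOn_id.pow 2) fun t ht => pow_ne_zero 2 (hpos t ht).ne'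

theorem intervalIntegrable_const_div_pow (C : ℝ) (k : ℕ) {a b : ℝ} (ha : 0 < a) (hab : a ≤ b) :
    IntervalIntegrable (fun t : ℝ => C / t ^ k) MeasureTheory.volume a b := by
  refine ContinuousOn.intervalIntegrable ?_
  refine continuousOn_const.div (continuousOn_id.pow k) fun t ht => pow_ne_zero k ?_
  rw [Set.uIcc_of_le hab] at ht
  exact (ha.trans_le ht.1).ne'

theorem intervalIntegrable_indicator_Ici_one_div_sq (y : ℝ) {a b : ℝ} (ha : 0 < a) (hab : a ≤ b) :
    IntervalIntegrable ((Set.Ici y).indicator fun t : ℝ => 1 / t ^ 2)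
      MeasureTheory.volume a b := by
  rw [intervalIntegrable_iff]
  exact (intervalIntegrable_iff.mp (intervalIntegrable_const_div_pow 1 2 ha hab)).indicator
    measurableSet_Ici

theorem integral_indicator_Ici_one_div_sq {y a b : ℝ} (ha : 0 < a) (hay : a ≤ y) (hyb : y ≤ b) :
    ∫ t in a..b, (Set.Ici y).indicator (fun t : ℝ => 1 / t ^ 2) t = 1 / y - 1 / b := by
  rw [← intervalIntegral.integral_add_adjacent_intervals
    (intervalIntegrable_indicator_Ici_one_div_sq y ha hay)
    (intervalIntegrable_indicator_Ici_one_div_sq y (ha.trans_le hay) hyb)]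
  have h1 : ∫ t in a..y, (Set.Ici y).indicator (fun t : ℝ => 1 / t ^ 2) t = 0 := by
    rw [← intervalIntegral.integral_zero (a := a) (b := y) (μ := MeasureTheory.volume)]
    refine intervalIntegral.integral_congr_ae ?_
    filter_upwards [MeasureTheory.Measure.ae_ne MeasureTheory.volume y] with t hty ht
    rw [Set.uIoc_of_le hay] at ht
    exact Set.indicator_of_notMem (fun h => hty (le_antisymm ht.2 h)) _
  have h2 : ∫ t in y..b, (Set.Ici y).indicator (fun t : ℝ => 1 / t ^ 2) t =
      ∫ t in y..b, 1 / t ^ 2 := by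
    refine intervalIntegral.integral_congr fun t ht => ?_
    rw [Set.uIcc_of_le hyb] at ht
    exact Set.indicator_of_mem (Set.mem_Ici.mpr ht.1) _
  rw [h1, h2, integral_one_div_sq (ha.trans_le hay) hyb, zero_add]

/-- Partial summation: the sum of reciprocals `1 / y i` is governed by the counting function of
the `y i`, with a relative error `K` at scales below `δ` and an absolute error `D` above `δ`. -/
theorem abs_sum_one_div_sub_le {ι : Type*} (s : Finset ι) (y : ι → ℝ) {a δ b M D K : ℝ}
    (ha : 0 < a) (haδ : a ≤ δ) (hδ : δ ≤ b) (hD0 : 0 ≤ D)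
    (hy : ∀ i ∈ s, a ≤ y i ∧ y i ≤ b)
    (hK : ∀ t, a ≤ t → t ≤ δ → |((s.filter fun i => y i ≤ t).card : ℝ) - M * t| ≤ K * t)
    (hD : ∀ t, δ ≤ t → t ≤ b → |((s.filter fun i => y i ≤ t).card : ℝ) - M * t| ≤ D) :
    |∑ i ∈ s, 1 / y i - s.card / b - M * Real.log (b / a)| ≤ K * Real.log (δ / a) + D / δ := by
  have hab := haδ.trans hδ
  have hδ0 := ha.trans_le haδ
  have hb0 := ha.trans_le hab
  -- This is (A(t) - Mt)/t² with A the counting function; its integral over [a, b] is exactly the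
  -- quantity to bound, since 1/y = 1/b + ∫ 1/t² over [y, b].
  set h : ℝ → ℝ := fun t =>
    ∑ i ∈ s, (Set.Ici (y i)).indicator (fun t : ℝ => 1 / t ^ 2) t - M * t⁻¹ with hh
  have hsum : ∀ t, ∑ i ∈ s, (Set.Ici (y i)).indicator (fun t : ℝ => 1 / t ^ 2) t =
      ((s.filter fun i => y i ≤ t).card : ℝ) / t ^ 2 := by
    intro t
    simp only [Set.indicator_apply, Set.mem_Ici]
    rw [← Finset.sum_filter, Finset.sum_const, nsmul_eq_mul, mul_one_div]
  have hnorm : ∀ t, 0 < t →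
      ‖h t‖ = |((s.filter fun i => y i ≤ t).card : ℝ) - M * t| / t ^ 2 := by
    intro t ht
    rw [← abs_of_pos (pow_pos ht 2), ← abs_div, hh, Real.norm_eq_abs]
    simp only [hsum]
    congr 1
    field_simp
  have hinv : ∀ {u v : ℝ}, 0 < u → u ≤ v → IntervalIntegrable (fun t : ℝ => M * t⁻¹)
      MeasureTheory.volume u v := by
    intro u v hu huv
    simpa [div_eq_mul_inv] using intervalIntegrable_const_div_pow M 1 hu huv
  have hsumint : ∀ {u v : ℝ}, 0 < u → u ≤ v → IntervalIntegrable
      (fun t : ℝ => ∑ i ∈ s, (Set.Ici (y i)).indicator (fun t : ℝ => 1 / t ^ 2) t)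
      MeasureTheory.volume u v := by
    intro u v hu huv
    have := IntervalIntegrable.sum s (μ := MeasureTheory.volume) (a := u) (b := v)
      (f := fun i => (Set.Ici (y i)).indicator fun t : ℝ => 1 / t ^ 2)
      fun i _ => intervalIntegrable_indicator_Ici_one_div_sq (y i) hu huv
    rwa [Finset.sum_fn] at this
  have hint : ∀ {u v : ℝ}, 0 < u → u ≤ v → IntervalIntegrable h MeasureTheory.volume u v :=
    fun hu huv => (hsumint hu huv).sub (hinv hu huv)
  have htotal : ∫ t in a..b, h t =
      ∑ i ∈ s, 1 / y i - s.card / b - M * Real.log (b / a) := by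
    rw [hh, intervalIntegral.integral_sub (hsumint ha hab) (hinv ha hab),
      intervalIntegral.integral_finsetSum
        fun i _ => intervalIntegrable_indicator_Ici_one_div_sq (y i) ha hab,
      intervalIntegral.integral_const_mul, integral_inv_of_pos ha hb0,
      Finset.sum_congr rfl fun i hi =>
        integral_indicator_Ici_one_div_sq ha (hy i hi).1 (hy i hi).2,
      Finset.sum_sub_distrib, Finset.sum_const, nsmul_eq_mul, mul_one_div]
  have hsmall : ‖∫ t in a..δ, h t‖ ≤ K * Real.log (δ / a) := by
    rw [← integral_inv_of_pos ha hδ0, ← intervalIntegral.integral_const_mul]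
    refine intervalIntegral.norm_integral_le_of_norm_le haδ (.of_forall fun t ht => ?_) ?_
    · have ht0 := ha.trans ht.1
      rw [hnorm t ht0, div_le_iff₀ (by positivity)]
      calc _ ≤ K * t := hK t ht.1.le ht.2
        _ = _ := by field_simp
    · simpa [div_eq_mul_inv] using intervalIntegrable_const_div_pow K 1 ha haδ
  have hlarge : ‖∫ t in δ..b, h t‖ ≤ D / δ := by
    calc ‖∫ t in δ..b, h t‖ ≤ ∫ t in δ..b, D * (1 / t ^ 2) := by
          refine intervalIntegral.norm_integral_le_of_norm_le hδ (.of_forall fun t ht => ?_) ?_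
          · have ht0 := hδ0.trans ht.1
            rw [hnorm t ht0, mul_one_div]
            have := hD t ht.1.le ht.2
            gcongr
          · simpa [div_eq_mul_inv] using intervalIntegrable_const_div_pow D 2 hδ0 hδ
      _ ≤ D / δ := by
          rw [intervalIntegral.integral_const_mul, integral_one_div_sq hδ0 hδ, div_eq_mul_one_div D δ]
          have : 0 ≤ 1 / b := by positivity
          exact mul_le_mul_of_nonneg_left (by linarith) hD0
  rw [← htotal, ← intervalIntegral.integral_add_adjacent_intervals (hint ha haδ) (hint hδ0 hδ)]
  exact (norm_add_le _ _).trans (add_le_add hsmall hlarge)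

/-! ### Two-sided count with logarithmic error -/

theorem card_filter_Icc_eq_countNear (α β : ℝ) (N : ℕ) (t : ℝ) :
    ((Finset.Icc 1 N).filter fun n : ℕ => distNearestInt (n * α + β) ≤ t).card =
      countNear α (β + α) N t := by
  have hIcc : Finset.Icc 1 N = Finset.Ico 1 (N + 1) := by ext; simp
  simp only [countNear, Finset.card_filter]
  rw [hIcc, Finset.sum_Ico_eq_sum_range]
  refine Finset.sum_congr rfl fun n _ => ?_
  have : ((1 + n : ℕ) : ℝ) * α + β = n * α + (β + α) := by push_cast; ring
  rw [this]

theorem one_le_truncLog (x : ℝ) : 1 ≤ truncLog x := by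
  rw [truncLog, Real.le_log_iff_exp_le (lt_max_of_lt_left (Real.exp_pos 1))]
  exact le_max_left _ _

theorem log_le_truncLog {x : ℝ} (hx : 0 < x) : Real.log x ≤ truncLog x :=
  Real.log_le_log hx (le_max_right _ _)

theorem truncLog_mono : Monotone truncLog := fun _ _ h =>
  Real.log_le_log (lt_max_of_lt_left (Real.exp_pos 1)) (max_le_max le_rfl h)

theorem truncLog_le_self {x : ℝ} (hx : 1 ≤ x) : truncLog x ≤ x := by
  rw [truncLog, Real.log_le_iff_le_exp (lt_max_of_lt_left (Real.exp_pos 1))]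
  exact max_le (Real.exp_le_exp.mpr hx) (by linarith [Real.add_one_le_exp x])

theorem abs_card_filter_sub_le {α c : ℝ} (hc : 0 < c) (hc1 : c ≤ 1)
    (hα : ∀ n : ℕ, 1 ≤ n → c ≤ n * distNearestInt (n * α)) (β : ℝ) {N : ℕ} (hN : 1 ≤ N)
    {t : ℝ} (ht : 0 ≤ t) (ht2 : t ≤ 1 / 2) :
    |(((Finset.Icc 1 N).filter fun n : ℕ => distNearestInt (n * α + β) ≤ t).card : ℝ)
      - 2 * N * t| ≤ 6 / c * truncLog N := by
  have hN0 : (0 : ℝ) < N := by exact_mod_cast hN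
  have herr : 3 + 3 / c * Real.log N ≤ 6 / c * truncLog N := by
    have h1 := log_le_truncLog hN0
    have h2 := one_le_truncLog N
    have h3 : 3 ≤ 3 / c := by rw [le_div_iff₀ hc]; linarith
    have h4 : 3 / c * Real.log N ≤ 3 / c * truncLog N := by gcongr
    have h5 : 3 / c * 1 ≤ 3 / c * truncLog N := by gcongr
    have h6 : 6 / c * truncLog N = 3 / c * truncLog N + 3 / c * truncLog N := by ring
    linarith
  have hupper := countNear_le hc hα ht N hN (β + α)
  have hcompl := countNear_le hc hα (by linarith : 0 ≤ 1 / 2 - t) N hN (β + 1 / 2 + α)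
  rw [← card_filter_Icc_eq_countNear] at hupper hcompl
  have hsplit := Finset.card_filter_add_card_filter_not (s := Finset.Icc 1 N)
    (fun n : ℕ => distNearestInt (n * α + β) ≤ t)
  -- Points farther than t from every integer are within 1/2 - t of one after a shift by 1/2, so an
  -- upper bound on them bounds A(t) below.
  have hsub : ((Finset.Icc 1 N).filter fun n : ℕ => ¬ distNearestInt (n * α + β) ≤ t).card ≤
      ((Finset.Icc 1 N).filter fun n : ℕ =>
        distNearestInt (n * α + (β + 1 / 2)) ≤ 1 / 2 - t).card := by
    refine Finset.card_le_card (Finset.monotone_filter_right _ fun n _ hn => ?_)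
    have := distNearestInt_add_half_le (n * α + β)
    rw [add_assoc] at this
    linarith
  rw [Nat.card_Icc, Nat.add_sub_cancel] at hsplit
  have hsplit' := congrArg (Nat.cast : ℕ → ℝ) hsplit
  have hsub' : (_ : ℝ) ≤ _ := Nat.cast_le.mpr hsub
  push_cast at hsplit'
  rw [abs_le]
  constructor <;> linarith

/-! ### Separation of the points and small scales -/

theorem div_le_abs_mul_sub_intCast {α c : ℝ}
    (hα : ∀ n : ℕ, 1 ≤ n → c ≤ n * distNearestInt (n * α)) {N n m : ℕ}
    (hn : n ∈ Finset.Icc 1 N) (hm : m ∈ Finset.Icc 1 N) (hnm : n ≠ m) (k : ℤ) :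
    c / N ≤ |((n : ℝ) - m) * α - k| := by
  wlog hlt : m < n generalizing n m k
  · have := this hm hn hnm.symm (-k) (by omega)
    rw [← abs_neg] at this
    convert this using 2
    push_cast
    ring
  obtain ⟨d, rfl⟩ := Nat.exists_eq_add_of_lt hlt
  rw [Finset.mem_Icc] at hn hm
  have h1 := hα (d + 1) (by omega)
  have h2 := distNearestInt_le_abs_sub_intCast ((d + 1 : ℕ) * α) k
  have hdN : ((d + 1 : ℕ) : ℝ) ≤ N := by exact_mod_cast (by omega)
  have hN0 : (0 : ℝ) < N := by exact_mod_cast (by omega)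
  have h3 : ((m + d + 1 : ℕ) : ℝ) - m = (d + 1 : ℕ) := by push_cast; ring
  rw [h3, div_le_iff₀ hN0, mul_comm]
  exact h1.trans (mul_le_mul hdN h2 (distNearestInt_nonneg _) hN0.le)

/-- Away from its minimiser, `‖n α + β‖` is at least `c / (2 N)`. -/
theorem div_le_distNearestInt_of_min {α c : ℝ}
    (hα : ∀ n : ℕ, 1 ≤ n → c ≤ n * distNearestInt (n * α)) {β : ℝ} {N n₀ n : ℕ}
    (hn₀ : n₀ ∈ Finset.Icc 1 N) (hn : n ∈ Finset.Icc 1 N) (hne : n ≠ n₀)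
    (hmin : distNearestInt (n₀ * α + β) ≤ distNearestInt (n * α + β)) :
    c / (2 * N) ≤ distNearestInt (n * α + β) := by
  have h := div_le_abs_mul_sub_intCast hα hn hn₀ hne
    (round (n * α + β) - round (n₀ * α + β))
  have h2 : c / (2 * (N : ℝ)) = c / N / 2 := by rw [div_div, mul_comm]
  have h3 := abs_sub (n * α + β - round (n * α + β)) (n₀ * α + β - round (n₀ * α + β))
  have h4 : (n * α + β - round (n * α + β)) - (n₀ * α + β - round (n₀ * α + β)) =
      ((n : ℝ) - n₀) * α - ((round (n * α + β) - round (n₀ * α + β) : ℤ) : ℝ) := by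
    push_cast; ring
  rw [h4] at h3
  unfold distNearestInt at hmin ⊢
  linarith

/-- Pigeonhole: a cell of length c/N holds at most one signed distance. The lower bound on t absorbs
the additive constant of the cell count. -/
theorem card_filter_le_of_separated {α c : ℝ} (hc : 0 < c)
    (hα : ∀ n : ℕ, 1 ≤ n → c ≤ n * distNearestInt (n * α)) (β : ℝ) {N : ℕ} (hN : 1 ≤ N)
    {t : ℝ} (ht : c / (2 * N) ≤ t) :
    (((Finset.Icc 1 N).filter fun n : ℕ => distNearestInt (n * α + β) ≤ t).card : ℝ) ≤
      8 * N / c * t := by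
  have hN0 : (0 : ℝ) < N := by exact_mod_cast hN
  have hcN : 0 < c / N := by positivity
  have hNt : 1 ≤ 2 * (t / (c / N)) := by
    rw [mul_div_assoc', le_div_iff₀ hcN]
    have h2 : c / (2 * (N : ℝ)) = c / N / 2 := by rw [div_div, mul_comm]
    linarith
  have hcard : ((Finset.Icc 1 N).filter fun n : ℕ => distNearestInt (n * α + β) ≤ t).card ≤
      (Finset.Icc ⌈-(t / (c / N)) - 1⌉ ⌊t / (c / N)⌋).card := by
    refine Finset.card_le_card_of_injOn
      (fun n : ℕ => ⌊(n * α + β - round (n * α + β)) / (c / N)⌋) ?_ ?_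
    · intro n hn
      simp only [Finset.coe_filter, Set.mem_ofPred_eq] at hn
      have h := abs_le.mp hn.2
      have h1 : (n * α + β - round (n * α + β)) / (c / N) ≤ t / (c / N) := by gcongr; exact h.2
      have h2 : -t / (c / N) ≤ (n * α + β - round (n * α + β)) / (c / N) := by
        gcongr; exact h.1
      rw [neg_div] at h2
      simp only [Finset.coe_Icc, Set.mem_Icc]
      refine ⟨Int.ceil_le.mpr ?_, Int.le_floor.mpr ?_⟩
      · linarith [Int.sub_one_lt_floor ((n * α + β - round (n * α + β)) / (c / N))]
      · exact (Int.floor_le _).trans h1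
    · intro n hn m hm hnm
      simp only [Finset.coe_filter, Set.mem_ofPred_eq] at hn hm
      by_contra hne
      have h := div_le_abs_mul_sub_intCast hα hn.1 hm.1 hne
        (round (n * α + β) - round (m * α + β))
      have h1 := Int.abs_sub_lt_one_of_floor_eq_floor hnm
      rw [← sub_div, abs_div, abs_of_pos hcN, div_lt_one hcN] at h1
      refine h1.not_ge (h.trans_eq ?_)
      congr 1
      push_cast
      ring
  calc (((Finset.Icc 1 N).filter fun n : ℕ => distNearestInt (n * α + β) ≤ t).card : ℝ) ≤ _ := by
        exact_mod_cast hcard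
    _ ≤ _ := card_int_Icc_le (by linarith)
    _ ≤ 8 * (t / (c / N)) := by linarith
    _ = _ := by field_simp

/-! ### The unweighted sums -/

theorem exists_sum_erase_bound {α c : ℝ} (hc : 0 < c) (hc1 : c ≤ 1)
    (hα : ∀ n : ℕ, 1 ≤ n → c ≤ n * distNearestInt (n * α)) :
    ∃ C : ℝ, ∀ (β : ℝ) (N n₀ : ℕ), 1 ≤ N → n₀ ∈ Finset.Icc 1 N →
      (∀ n ∈ Finset.Icc 1 N, distNearestInt (n₀ * α + β) ≤ distNearestInt (n * α + β)) →
      |(∑ n ∈ (Finset.Icc 1 N).erase n₀, 1 / distNearestInt (n * α + β))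
          - 2 * N * Real.log N| ≤ C * (N * truncLog (truncLog N)) := by
  refine ⟨4 + 2 * Real.log (1 / c) + 8 / c * (1 + Real.log (1 / c)) + 14 / c, ?_⟩
  intro β N n₀ hN hn₀ hmin
  have hN0 : (0 : ℝ) < N := by exact_mod_cast hN
  have hN1 : (1 : ℝ) ≤ N := by exact_mod_cast hN
  set L := truncLog N with hL
  have hL1 : 1 ≤ L := one_le_truncLog N
  have hLN : L ≤ N := truncLog_le_self hN1
  have hLL1 : 1 ≤ truncLog L := one_le_truncLog L
  have hLL : Real.log L ≤ truncLog L := log_le_truncLog (by linarith)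
  have hlc : 0 ≤ Real.log (1 / c) := Real.log_nonneg (by rw [le_div_iff₀ hc]; linarith)
  have hcinv : 1 ≤ 1 / c := by rw [le_div_iff₀ hc]; linarith
  have hle : ∀ t, ((((Finset.Icc 1 N).erase n₀).filter
      fun n : ℕ => distNearestInt (n * α + β) ≤ t).card : ℝ) ≤
      (((Finset.Icc 1 N).filter fun n : ℕ => distNearestInt (n * α + β) ≤ t).card : ℝ) := by
    intro t
    exact_mod_cast Finset.card_le_card
      (Finset.filter_subset_filter _ (Finset.erase_subset _ _))
  have hge : ∀ t, (((Finset.Icc 1 N).filter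
      fun n : ℕ => distNearestInt (n * α + β) ≤ t).card : ℝ) ≤
      ((((Finset.Icc 1 N).erase n₀).filter
        fun n : ℕ => distNearestInt (n * α + β) ≤ t).card : ℝ) + 1 := by
    intro t
    rw [Finset.filter_erase]
    exact_mod_cast Nat.sub_le_iff_le_add.mp Finset.pred_card_le_card_erase
  have ha : 0 < c / (2 * N) := by positivity
  -- At this δ, D/δ is O(N) and K log(δ/a) is O(N(1 + log L)). In D, 7/c is 6/c from the count plus
  -- 1/c for the erased point.
  have key := abs_sum_one_div_sub_le ((Finset.Icc 1 N).erase n₀)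
    (fun n : ℕ => distNearestInt (n * α + β)) (a := c / (2 * N)) (δ := L / (2 * N)) (b := 1 / 2)
    (M := 2 * N) (D := 7 / c * L) (K := 8 * N / c) ha
    (by gcongr; linarith)
    (by rw [div_le_div_iff₀ (by positivity) (by norm_num)]; linarith)
    (by positivity)
    (fun n hn => ⟨div_le_distNearestInt_of_min hα hn₀ (Finset.mem_of_mem_erase hn)
      (Finset.ne_of_mem_erase hn) (hmin n (Finset.mem_of_mem_erase hn)),
      distNearestInt_le_half _⟩)
    (fun t ht _ => by
      have h1 := (hle t).trans (card_filter_le_of_separated hc hα β hN ht)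
      have ht0 : 0 ≤ t := ha.le.trans ht
      have h2 : 2 * N * t ≤ 8 * N / c * t := by
        have : 8 * N / c * t = 8 * N * t * (1 / c) := by ring
        rw [this]
        nlinarith [mul_nonneg hN0.le ht0]
      rw [abs_le]
      constructor
      · linarith [Nat.cast_nonneg (α := ℝ) (((Finset.Icc 1 N).erase n₀).filter
          fun n : ℕ => distNearestInt (n * α + β) ≤ t).card]
      · nlinarith [mul_nonneg hN0.le ht0])
    (fun t ht ht2 => by
      have ht0 : 0 ≤ t := le_trans (by positivity) ht
      have h := abs_le.mp (abs_card_filter_sub_le hc hc1 hα β hN ht0 ht2)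
      have h7 : 7 / c * L = 6 / c * L + 1 / c * L := by ring
      have h8 : 1 ≤ 1 / c * L := one_le_mul_of_one_le_of_one_le hcinv hL1
      rw [h7, abs_le]
      constructor <;> linarith [h.1, h.2, hle t, hge t])
  have hcard : (((Finset.Icc 1 N).erase n₀).card : ℝ) = N - 1 := by
    rw [Finset.card_erase_of_mem hn₀, Nat.card_Icc, Nat.add_sub_cancel, Nat.cast_sub hN,
      Nat.cast_one]
  have hmain : Real.log (1 / 2 / (c / (2 * N))) = Real.log N + Real.log (1 / c) := by
    rw [← Real.log_mul hN0.ne' (by positivity)]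
    congr 1
    field_simp
  have hratio : Real.log (L / (2 * N) / (c / (2 * N))) = Real.log L + Real.log (1 / c) := by
    rw [← Real.log_mul (by linarith) (by positivity)]
    congr 1
    field_simp
  have htail : 7 / c * L / (L / (2 * N)) = 14 / c * N := by field_simp; norm_num
  rw [hcard, hmain, hratio, htail] at key
  set S := ∑ n ∈ (Finset.Icc 1 N).erase n₀, 1 / distNearestInt (n * α + β)
  have hfirst : |S - 2 * N * Real.log N| ≤
      N * (2 + 2 * Real.log (1 / c) + 8 / c * (truncLog L + Real.log (1 / c)) + 14 / c) := by
    have h1 : 8 * N / c * (Real.log L + Real.log (1 / c)) ≤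
        8 * N / c * (truncLog L + Real.log (1 / c)) := by gcongr
    have h2 : 0 ≤ 2 * N * Real.log (1 / c) := by positivity
    have h3 : (N : ℝ) * (2 + 2 * Real.log (1 / c) + 8 / c * (truncLog L + Real.log (1 / c))
        + 14 / c) = 2 * N + 2 * N * Real.log (1 / c)
        + 8 * N / c * (truncLog L + Real.log (1 / c)) + 14 / c * N := by ring
    rw [abs_le] at key ⊢
    rw [h3]
    constructor <;> linarith [key.1, key.2]
  refine hfirst.trans ?_
  have hfactor : 2 + 2 * Real.log (1 / c) + 8 / c * (truncLog L + Real.log (1 / c)) + 14 / c ≤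
      (4 + 2 * Real.log (1 / c) + 8 / c * (1 + Real.log (1 / c)) + 14 / c) * truncLog L := by
    have h1 : 0 ≤ 2 + 2 * Real.log (1 / c) + 8 / c * Real.log (1 / c) + 14 / c := by positivity
    nlinarith [mul_le_mul_of_nonneg_left hLL1 h1]
  calc (N : ℝ) * _ ≤ N * _ := mul_le_mul_of_nonneg_left hfactor hN0.le
    _ = _ := by ring

theorem exists_sum_bound {α c c' : ℝ} (hc : 0 < c) (hc1 : c ≤ 1)
    (hα : ∀ n : ℕ, 1 ≤ n → c ≤ n * distNearestInt (n * α)) {β : ℝ} (hc' : 0 < c')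
    (hβ : ∀ n : ℕ, 1 ≤ n →
      c' ≤ n * truncLog (truncLog n) * distNearestInt (n * α + β)) :
    ∃ C : ℝ, ∀ N : ℕ, 1 ≤ N →
      |(∑ n ∈ Finset.Icc 1 N, 1 / distNearestInt (n * α + β))
          - 2 * N * Real.log N| ≤ C * (N * truncLog (truncLog N)) := by
  obtain ⟨C, hC⟩ := exists_sum_erase_bound hc hc1 hα
  refine ⟨C + 1 / c', fun N hN => ?_⟩
  obtain ⟨n₀, hn₀, hmin⟩ := Finset.exists_min_image (Finset.Icc 1 N)
    (fun n : ℕ => distNearestInt (n * α + β)) ⟨1, Finset.mem_Icc.mpr ⟨le_rfl, hN⟩⟩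
  have h := abs_le.mp (hC β N n₀ hN hn₀ hmin)
  rw [Finset.mem_Icc] at hn₀
  have hn₀N : (n₀ : ℝ) ≤ N := by exact_mod_cast hn₀.2
  have hb := hβ n₀ hn₀.1
  have hmono : (n₀ : ℝ) * truncLog (truncLog n₀) ≤ N * truncLog (truncLog N) :=
    mul_le_mul hn₀N (truncLog_mono (truncLog_mono hn₀N))
      (zero_le_one.trans (one_le_truncLog _)) (Nat.cast_nonneg N)
  have hpos : 0 < distNearestInt (n₀ * α + β) := by
    refine (distNearestInt_nonneg _).lt_of_ne fun h0 => ?_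
    rw [← h0, mul_zero] at hb
    linarith
  have hterm : 1 / distNearestInt (n₀ * α + β) ≤ 1 / c' * (N * truncLog (truncLog N)) := by
    rw [div_le_iff₀ hpos, one_div, inv_mul_eq_div, div_mul_eq_mul_div, le_div_iff₀ hc', one_mul]
    exact hb.trans (mul_le_mul_of_nonneg_right hmono hpos.le)
  have hterm0 : 0 ≤ 1 / distNearestInt (n₀ * α + β) := by positivity
  rw [← Finset.add_sum_erase _ _ (Finset.mem_Icc.mpr hn₀), add_mul, abs_le]
  have h0 : 0 ≤ 1 / c' * (N * truncLog (truncLog N)) := hterm0.trans hterm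
  constructor <;> linarith [h.1, h.2]

/-! ### The weighted sum -/

/-- Abel summation for logarithmically weighted sums. -/
theorem sum_div_eq_sum_partialSums (a : ℕ → ℝ) (N : ℕ) :
    ∑ n ∈ Finset.Icc 1 N, a n / n =
      (∑ n ∈ Finset.Icc 1 N, a n) / (N + 1)
        + ∑ n ∈ Finset.Icc 1 N, (∑ k ∈ Finset.Icc 1 n, a k) / (n * (n + 1)) := by
  induction N with
  | zero => simp
  | succ N ih =>
    simp only [Finset.sum_Icc_succ_top (Nat.le_add_left 1 N), ih]
    push_cast
    field_simp
    ring

theorem sum_one_div_le_one_add_log (N : ℕ) :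
    ∑ n ∈ Finset.Icc 1 N, 1 / (n : ℝ) ≤ 1 + Real.log N := by
  have h := harmonic_le_one_add_log N
  rw [harmonic_eq_sum_Icc] at h
  push_cast at h
  simpa [one_div] using h

/-- Each increment of log² is 2 log(N+1)·(log(N+1) - log N) up to a square, and differs from the new
summand by at most 4/(N+1). -/
theorem abs_sum_log_div_sub_log_sq_le (N : ℕ) (hN : 1 ≤ N) :
    |∑ n ∈ Finset.Icc 1 N, 2 * Real.log n / (n + 1) - Real.log N ^ 2| ≤
      4 * ∑ n ∈ Finset.Icc 1 N, 1 / (n : ℝ) := by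
  induction N, hN using Nat.le_induction with
  | base => norm_num
  | succ N hN ih =>
    have hN1 : (1 : ℝ) ≤ N := by exact_mod_cast hN
    rw [Finset.sum_Icc_succ_top (Nat.le_add_left 1 N), Finset.sum_Icc_succ_top (Nat.le_add_left 1 N)]
    push_cast
    set l := Real.log N
    set l' := Real.log (N + 1)
    have hquot : l' - l = Real.log (((N : ℝ) + 1) / N) :=
      (Real.log_div (by positivity) (by positivity)).symm
    have hd1 : 1 / ((N : ℝ) + 1) ≤ l' - l := by
      rw [hquot]
      refine le_trans (le_of_eq ?_) (Real.one_sub_inv_le_log_of_pos (by positivity))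
      field_simp
      ring
    have hd2 : l' - l ≤ 1 / N := by
      rw [hquot]
      refine (Real.log_le_sub_one_of_pos (by positivity)).trans (le_of_eq ?_)
      field_simp
      ring
    have hl0 : 0 ≤ l' := Real.log_nonneg (by linarith)
    have hlN : l' ≤ N := by
      have := Real.log_le_sub_one_of_pos (x := (N : ℝ) + 1) (by positivity)
      linarith
    have hd0 : 0 ≤ l' - l := le_trans (by positivity) hd1
    have hlow : 2 * l' / (N + 1 + 1) ≤ 2 * l' * (l' - l) := by
      rw [div_eq_mul_one_div]
      refine mul_le_mul_of_nonneg_left (le_trans ?_ hd1) (by positivity)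
      gcongr
      linarith
    have hsq : (l' - l) ^ 2 ≤ 4 * (1 / ((N : ℝ) + 1)) := by
      calc (l' - l) ^ 2 ≤ (1 / (N : ℝ)) ^ 2 := by gcongr
        _ ≤ 4 * (1 / ((N : ℝ) + 1)) := by
          rw [div_pow, mul_one_div, one_pow, div_le_div_iff₀ (by positivity) (by positivity)]
          nlinarith
    have hup : 2 * l' * (l' - l) - 2 * l' / (N + 1 + 1) ≤ 4 * (1 / ((N : ℝ) + 1)) := by
      calc 2 * l' * (l' - l) - 2 * l' / (N + 1 + 1)
          ≤ 2 * l' * (1 / N) - 2 * l' / (N + 1 + 1) := by gcongr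
        _ = l' * (4 / (N * (N + 1 + 1))) := by field_simp; ring
        _ ≤ N * (4 / (N * (N + 1 + 1))) := by gcongr
        _ = 4 * (1 / ((N : ℝ) + 1 + 1)) := by field_simp
        _ ≤ _ := by gcongr; linarith
    have hdiff : l' ^ 2 - l ^ 2 = 2 * l' * (l' - l) - (l' - l) ^ 2 := by ring
    rw [abs_le] at ih ⊢
    constructor <;> linarith [ih.1, ih.2, sq_nonneg (l' - l)]

theorem exists_weighted_sum_bound {a : ℕ → ℝ} {C : ℝ}
    (hC : ∀ N : ℕ, 1 ≤ N →
      |(∑ n ∈ Finset.Icc 1 N, a n) - 2 * N * Real.log N| ≤ C * (N * truncLog (truncLog N))) :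
    ∃ C' : ℝ, ∀ N : ℕ, 1 ≤ N →
      |(∑ n ∈ Finset.Icc 1 N, a n / n) - Real.log N ^ 2| ≤
        C' * (truncLog N * truncLog (truncLog N)) := by
  have hC0 : 0 ≤ C := by
    have h := (abs_nonneg _).trans (hC 1 le_rfl)
    have h1 := one_le_truncLog (truncLog ((1 : ℕ) : ℝ))
    rw [Nat.cast_one, one_mul] at h
    rw [Nat.cast_one] at h1
    exact nonneg_of_mul_nonneg_left h (by linarith)
  -- The boundary term costs 2 log N + C·LL, the replaced partial sums C·LL·H, and the main sum 4H,
  -- with H ≤ 2L(N).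
  refine ⟨10 + 3 * C, fun N hN => ?_⟩
  have hN0 : (0 : ℝ) < N := by exact_mod_cast hN
  set LL := truncLog (truncLog N) with hLL
  have hLL1 : 1 ≤ LL := one_le_truncLog _
  have hL1 : 1 ≤ truncLog N := one_le_truncLog _
  have hlog : Real.log N ≤ truncLog N := log_le_truncLog hN0
  have hlog0 : 0 ≤ Real.log N := Real.log_natCast_nonneg N
  set H := ∑ n ∈ Finset.Icc 1 N, 1 / (n : ℝ) with hH
  have hHlog : H ≤ 1 + Real.log N := sum_one_div_le_one_add_log N
  have hmain := abs_le.mp (abs_sum_log_div_sub_log_sq_le N hN)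
  have hlast : |(∑ n ∈ Finset.Icc 1 N, a n) / (N + 1)| ≤ 2 * Real.log N + C * LL := by
    have h := abs_le.mp (hC N hN)
    have h1 : 0 ≤ 2 * Real.log N + C * LL := by positivity
    rw [abs_div, abs_of_pos (by positivity : (0 : ℝ) < N + 1), div_le_iff₀ (by positivity), abs_le]
    have h2 : 0 ≤ N * Real.log N := by positivity
    constructor <;> nlinarith [h.1, h.2]
  have herr : |∑ n ∈ Finset.Icc 1 N, (∑ k ∈ Finset.Icc 1 n, a k) / (n * (n + 1))
      - ∑ n ∈ Finset.Icc 1 N, 2 * Real.log n / (n + 1)| ≤ C * LL * H := by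
    rw [← Finset.sum_sub_distrib, hH, Finset.mul_sum]
    refine (Finset.abs_sum_le_sum_abs _ _).trans (Finset.sum_le_sum fun n hn => ?_)
    rw [Finset.mem_Icc] at hn
    have hn0 : (0 : ℝ) < n := by exact_mod_cast hn.1
    have hnN : (n : ℝ) ≤ N := by exact_mod_cast hn.2
    have h1 : (∑ k ∈ Finset.Icc 1 n, a k) / ((n : ℝ) * (n + 1)) - 2 * Real.log n / (n + 1) =
        ((∑ k ∈ Finset.Icc 1 n, a k) - 2 * n * Real.log n) / (n * (n + 1)) := by
      field_simp
    have h2 : truncLog (truncLog n) ≤ LL := truncLog_mono (truncLog_mono hnN)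
    rw [h1, abs_div, abs_of_pos (by positivity : (0 : ℝ) < n * (n + 1))]
    calc _ ≤ C * (n * LL) / (n * (n + 1)) := by
          gcongr
          exact (hC n hn.1).trans (by gcongr)
      _ = C * LL * (1 / ((n : ℝ) + 1)) := by field_simp
      _ ≤ _ := by gcongr; linarith
  have hprod : truncLog N ≤ truncLog N * LL := le_mul_of_one_le_right (by linarith) hLL1
  have hCprod : C * LL ≤ C * (truncLog N * LL) := by
    gcongr
    exact le_mul_of_one_le_left (by linarith) hL1
  have hCH : C * LL * H ≤ 2 * (C * (truncLog N * LL)) := by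
    calc C * LL * H ≤ C * LL * (2 * truncLog N) := by gcongr; linarith
      _ = _ := by ring
  rw [sum_div_eq_sum_partialSums]
  rw [abs_le] at hlast herr ⊢
  have htotal : (10 + 3 * C) * (truncLog N * LL) =
      10 * (truncLog N * LL) + 3 * (C * (truncLog N * LL)) := by ring
  rw [htotal]
  constructor <;> linarith [hlast.1, hlast.2, herr.1, herr.2, hmain.1, hmain.2]

theorem exists_pos_le_of_iInf_pos {f : ℕ → ℝ} (hf : ∀ n, 0 ≤ f n)
    (h : 0 < ⨅ n : ℕ+, f n) : ∃ c, 0 < c ∧ c ≤ 1 ∧ ∀ n : ℕ, 1 ≤ n → c ≤ f n := by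
  -- Capping at 1 gives 1/c ≥ 1, so that additive constants can be absorbed into multiples of 1/c.
  refine ⟨min (⨅ n : ℕ+, f n) 1, lt_min h one_pos, min_le_right _ _, fun n hn => ?_⟩
  have hbdd : BddBelow (Set.range fun n : ℕ+ => f n) := ⟨0, by rintro _ ⟨n, rfl⟩; exact hf n⟩
  exact (min_le_left _ _).trans (ciInf_le hbdd ⟨n, hn⟩)

theorem theorem6 (α : ℝ) (hα : IsBadlyApproximable α) :
    (∃ C : ℝ, ∀ (β : ℝ) (N n₀ : ℕ), 1 ≤ N → n₀ ∈ Finset.Icc 1 N →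
      (∀ n ∈ Finset.Icc 1 N, distNearestInt (n₀ * α + β) ≤ distNearestInt (n * α + β)) →
      |(∑ n ∈ (Finset.Icc 1 N).erase n₀, 1 / distNearestInt (n * α + β))
          - 2 * N * Real.log N| ≤ C * (N * truncLog (truncLog N))) ∧
    (∀ β : ℝ,
      0 < (⨅ n : ℕ+, ((n : ℕ) * truncLog (truncLog (n : ℕ))) *
          distNearestInt ((n : ℕ) * α + β)) →
      (∃ C : ℝ, ∀ N : ℕ, 1 ≤ N →
        |(∑ n ∈ Finset.Icc 1 N, 1 / distNearestInt (n * α + β))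
          - 2 * N * Real.log N| ≤ C * (N * truncLog (truncLog N))) ∧
      (∃ C : ℝ, ∀ N : ℕ, 1 ≤ N →
        |(∑ n ∈ Finset.Icc 1 N, 1 / (n * distNearestInt (n * α + β)))
          - (Real.log N) ^ 2| ≤ C * (truncLog N * truncLog (truncLog N)))) := by
  obtain ⟨c, hc, hc1, hcα⟩ := exists_pos_le_of_iInf_pos
    (f := fun n : ℕ => (n : ℝ) * distNearestInt (n * α))
    (fun n => mul_nonneg (Nat.cast_nonneg n) (distNearestInt_nonneg _)) hα.2
  refine ⟨exists_sum_erase_bound hc hc1 hcα, fun β hβ => ?_⟩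
  obtain ⟨c', hc', -, hcβ⟩ := exists_pos_le_of_iInf_pos
    (f := fun n : ℕ => (n : ℝ) * truncLog (truncLog n) * distNearestInt (n * α + β))
    (fun n => mul_nonneg (mul_nonneg (Nat.cast_nonneg n)
      (zero_le_one.trans (one_le_truncLog _))) (distNearestInt_nonneg _)) hβ
  obtain ⟨C, hC⟩ := exists_sum_bound hc hc1 hcα hc' hcβ
  refine ⟨⟨C, hC⟩, ?_⟩
  obtain ⟨C', hC'⟩ := exists_weighted_sum_bound hC
  refine ⟨C', fun N hN => ?_⟩
  have := hC' N hN
  simpa only [div_div, mul_comm (distNearestInt _)] using this
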